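/- \textbf{Theorem} (axiomatic completeness for the diamond fragments). Fix a countably infinite set $\mathrm{Var}$ of propositional variables. Formulas of $\mathcal{L}_{\Box\Diamond}$ are built from variables and the constants $\bot,\top$ with the binary connectives $\to,\land,\lor$ and the unary operators $\Box,\Diamond$; $\mathcal{L}_\Diamond$ is the sublanguage without $\Box$. Write $\lnot A$ for $A\to\bot$. \emph{Semantics.} For $x,y\in[0,1]$ let $x\to_{\mathsf G}y=y$ if $x>y$ and $x\to_{\mathsf G}y=1$ otherwise. A \emph{Kripke model for $\mathsf{GK^F}$} is a triple $\langle W,R,V\rangle$ with $W$ a non-empty set, $R:W\times W\to[0,1]$ and $V:\mathrm{Var}\times W\to[0,1]$, where $V$ is extended to all formulas by $V(\bot,x)=0$, $V(\top,x)=1$, $V(A\to B,x)=V(A,x)\to_{\mathsf G}V(B,x)$, $V(A\land B,x)=\min(V(A,x),V(B,x))$, $V(A\lor B,x)=\max(V(A,x),V(B,x))$, $V(\Box A,x)=\inf_{y\in W}(Rxy\to_{\mathsf G}V(A,y))$ and $V(\Diamond A,x)=\sup_{y\in W}\min(V(A,y),Rxy)$. It is a \emph{Kripke model for $\mathsf{GK}$}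 if moreover $Rxy\in\{0,1\}$ for all $x,y\in W$. For $\mathsf L\in\{\mathsf{GK},\mathsf{GK^F}\}$, $\models_{\mathsf L}A$ means that $V(A,x)=1$ for every Kripke model $\langle W,R,V\rangle$ for $\mathsf L$ and every $x\in W$. \emph{Hilbert systems.} $\mathsf{HG}$ has the rule of modus ponens (from $A$ and $A\to B$ infer $B$) and the axiom schemas (A1) $A\to(B\to A)$; (A2) $(A\land B)\to A$; (A3) $(A\land B)\to B$; (A4) $A\to(B\to(A\land B))$; (A5) $(\bot\to A)\land(A\to\top)$; (A6) $A\to(A\lor B)$; (A7) $B\to(A\lor B)$; (A8) $(A\to B)\to((C\to A)\to(C\to B))$; (A9) $(A\to(B\to C))\to(B\to(A\to C))$; (A10) $((A\to C)\land(B\to C))\to((A\lor B)\to C)$; (A11) $(A\to(B\to C))\to((A\land B)\to C)$; (A12) $((C\to A)\land(C\to B))\to(C\to(A\land B))$; (A13) $(A\to(A\to B))\to(A\to B)$; (A14) $(A\to B)\lor(B\to A)$. $\mathsf{HGK}_\Diamond$ is $\mathsf{HG}$, with $A,B,C$ ranging over $\mathcal{L}_\Diamond$-formulas, extended with the axiom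 schemas $(K_\Diamond)$ $\Diamond(A\lor B)\to(\Diamond A\lor\Diamond B)$, $(Z_\Diamond)$ $\Diamond\lnot\lnot A\to\lnot\lnot\Diamond A$, $(F_\Diamond)$ $\lnot\Diamond\bot$, and the rule: from $(A\to B)\lor C$ infer $(\Diamond A\to\Diamond B)\lor\Diamond C$. $\mathsf{HGK^F_\Diamond}$ is $\mathsf{HGK}_\Diamond$ with this last rule replaced by: from $A\to B$ infer $\Diamond A\to\Diamond B$. Write $\vdash_{\mathsf H}A$ if $A$ is derivable in the system $\mathsf H$ (without further hypotheses). \emph{Claim.} For every $\mathcal{L}_\Diamond$-formula $A$: \[ \models_{\mathsf{GK}}A \iff \vdash_{\mathsf{HGK}_\Diamond}A \qquad\text{and}\qquad \models_{\mathsf{GK^F}}A \iff \vdash_{\mathsf{HGK^F_\Diamond}}A . \] -/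

import Mathlib

/-! Formulas, Kripke semantics and Hilbert systems for Gödel modal logics. -/

universe u

namespace GodelModal

/-- Formulas of the full modal language with `□` and `◇` over the propositional
variables `p₀, p₁, p₂, …`. -/
inductive Fm : Type
  | var : ℕ → Fm
  | bot : Fm
  | top : Fm
  | imp : Fm → Fm → Fm
  | and : Fm → Fm → Fm
  | or : Fm → Fm → Fm
  | box : Fm → Fm
  | dia : Fm → Fm

/-- Formulas of the diamond sublanguage (no occurrence of `□`). -/
inductive DiaFm : Type
  | var : ℕ → DiaFm
  | bot : DiaFm
  | top : DiaFm
  | imp : DiaFm → DiaFm → DiaFm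
  | and : DiaFm → DiaFm → DiaFm
  | or : DiaFm → DiaFm → DiaFm
  | dia : DiaFm → DiaFm

/-- The inclusion of the diamond sublanguage into the full language. -/
def DiaFm.toFm : DiaFm → Fm
  | .var p => .var p
  | .bot => .bot
  | .top => .top
  | .imp A B => .imp A.toFm B.toFm
  | .and A B => .and A.toFm B.toFm
  | .or A B => .or A.toFm B.toFm
  | .dia A => .dia A.toFm

/-- Negation, `¬A := A → ⊥`. -/
def DiaFm.neg (A : DiaFm) : DiaFm := .imp A .bot

/-! ### Semantics -/

/-- The residuum of the Gödel t-norm `min` on `[0,1]`. -/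
noncomputable def gimp (x y : unitInterval) : unitInterval :=
  if y < x then y else 1

/-- A fuzzy Kripke model: a non-empty set of worlds, a `[0,1]`-valued accessibility
relation, and a valuation of the variables in `[0,1]` at each world. -/
structure KripkeModel where
  W : Type u
  nonempty : Nonempty W
  R : W → W → unitInterval
  val : ℕ → W → unitInterval

/-- The value of a formula at a world. The infima and suprema are taken in the
complete lattice `[0,1]`. -/
noncomputable def KripkeModel.V (K : KripkeModel.{u}) : Fm → K.W → unitInterval
  | .var p, x => K.val p x
  | .bot, _ => 0
  | .top, _ => 1
  | .imp A B, x => gimp (K.V A x) (K.V B x)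
  | .and A B, x => min (K.V A x) (K.V B x)
  | .or A B, x => max (K.V A x) (K.V B x)
  | .box A, x => ⨅ y : K.W, gimp (K.R x y) (K.V A y)
  | .dia A, x => ⨆ y : K.W, min (K.V A y) (K.R x y)

/-- The accessibility relation takes only the values `0` and `1`. -/
def KripkeModel.IsCrisp (K : KripkeModel.{u}) : Prop :=
  ∀ x y : K.W, K.R x y = 0 ∨ K.R x y = 1

/-- A formula is valid in a model if it takes the value `1` at every world. -/
def KripkeModel.Validates (K : KripkeModel.{u}) (A : Fm) : Prop :=
  ∀ x : K.W, K.V A x = 1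

/-- Validity in `GK`: validity in all models with crisp accessibility relation. -/
def GKValid (A : Fm) : Prop :=
  ∀ K : KripkeModel.{u}, K.IsCrisp → K.Validates A

/-- Validity in `GK^F`: validity in all fuzzy Kripke models. -/
def GKFValid (A : Fm) : Prop :=
  ∀ K : KripkeModel.{u}, K.Validates A

/-! ### Hilbert systems -/

/-- The axiom schemas of the Hilbert system `HG` for Gödel logic, with instances
in the diamond sublanguage. -/
inductive HGAxiom : DiaFm → Prop
  | A1 (A B : DiaFm) : HGAxiom (.imp A (.imp B A))
  | A2 (A B : DiaFm) : HGAxiom (.imp (.and A B) A)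
  | A3 (A B : DiaFm) : HGAxiom (.imp (.and A B) B)
  | A4 (A B : DiaFm) : HGAxiom (.imp A (.imp B (.and A B)))
  | A5 (A : DiaFm) : HGAxiom (.and (.imp .bot A) (.imp A .top))
  | A6 (A B : DiaFm) : HGAxiom (.imp A (.or A B))
  | A7 (A B : DiaFm) : HGAxiom (.imp B (.or A B))
  | A8 (A B C : DiaFm) :
      HGAxiom (.imp (.imp A B) (.imp (.imp C A) (.imp C B)))
  | A9 (A B C : DiaFm) :
      HGAxiom (.imp (.imp A (.imp B C)) (.imp B (.imp A C)))
  | A10 (A B C : DiaFm) :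
      HGAxiom (.imp (.and (.imp A C) (.imp B C)) (.imp (.or A B) C))
  | A11 (A B C : DiaFm) :
      HGAxiom (.imp (.imp A (.imp B C)) (.imp (.and A B) C))
  | A12 (A B C : DiaFm) :
      HGAxiom (.imp (.and (.imp C A) (.imp C B)) (.imp C (.and A B)))
  | A13 (A B : DiaFm) :
      HGAxiom (.imp (.imp A (.imp A B)) (.imp A B))
  | A14 (A B : DiaFm) : HGAxiom (.or (.imp A B) (.imp B A))

/-- The modal axiom schemas `(K_◇)`, `(Z_◇)` and `(F_◇)`. -/
inductive DiaAxiom : DiaFm → Prop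
  | K (A B : DiaFm) :
      DiaAxiom (.imp (.dia (.or A B)) (.or (.dia A) (.dia B)))
  | Z (A : DiaFm) :
      DiaAxiom (.imp (.dia A.neg.neg) (DiaFm.dia A).neg.neg)
  | F : DiaAxiom (DiaFm.dia .bot).neg

/-- Derivability in `HGK_◇`: modus ponens, and from `(A → B) ∨ C` infer
`(◇A → ◇B) ∨ ◇C`. -/
inductive HGKDia : DiaFm → Prop
  | hg {A : DiaFm} : HGAxiom A → HGKDia A
  | modal {A : DiaFm} : DiaAxiom A → HGKDia A
  | mp {A B : DiaFm} : HGKDia A → HGKDia (.imp A B) → HGKDia B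
  | nec {A B C : DiaFm} : HGKDia (.or (.imp A B) C) →
      HGKDia (.or (.imp (.dia A) (.dia B)) (.dia C))

/-- Derivability in `HGK^F_◇`: modus ponens, and from `A → B` infer `◇A → ◇B`. -/
inductive HGKFDia : DiaFm → Prop
  | hg {A : DiaFm} : HGAxiom A → HGKFDia A
  | modal {A : DiaFm} : DiaAxiom A → HGKFDia A
  | mp {A B : DiaFm} : HGKFDia A → HGKFDia (.imp A B) → HGKFDia B
  | nec {A B : DiaFm} : HGKFDia (.imp A B) →
      HGKFDia (.imp (.dia A) (.dia B))

end GodelModal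

namespace GodelModal

/-! ### Soundness -/

/-! Soundness is checked rule by rule. For completeness, the worlds are all Gödel valuations
(diamond formulas as atoms) giving every theorem value 1. Accessibility compares `w B` with `v (◇B)`
only for the finitely many `B` such that `◇B` occurs in the given formula: by an infimum of residua
in the fuzzy case, by 0 or 1 in the crisp one. The truth lemma `canonicalModel_V` needs, for each `d
< v (◇A)`, an accessible `w` with `w A ≥ d`. The modal rule and `exists_valuation_lt` give a `w` in
which `A` lies strictly above every `B` with `v (◇B) < v (◇A)`. Only the order is right so far;
`exists_rescaling` corrects the values, as valuations are stable under strictly increasing maps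
fixing 0 and 1. `exists_witness` combines the two. -/

theorem gimp_eq_one {x y : unitInterval} : gimp x y = 1 ↔ x ≤ y := by
  unfold gimp
  split_ifs with h
  · refine ⟨fun h1 => ?_, fun h1 => absurd h1 (not_le.2 h)⟩
    rw [h1] at h
    exact absurd h (not_lt.2 unitInterval.le_one')
  · simpa using h

theorem le_gimp (x y : unitInterval) : y ≤ gimp x y := by
  unfold gimp
  split_ifs
  · exact le_rfl
  · exact unitInterval.le_one'

theorem le_gimp_iff {x y z : unitInterval} : z ≤ gimp x y ↔ min z x ≤ y := by
  unfold gimp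
  split_ifs with h
  · simp [not_le.2 h]
  · simp only [not_lt] at h
    exact ⟨fun _ => min_le_of_right_le h, fun _ => unitInterval.le_one'⟩

theorem HGAxiom.sound {A : DiaFm} (h : HGAxiom A) (K : KripkeModel.{u}) (x : K.W) :
    K.V A.toFm x = 1 := by
  cases h with
  | A5 A =>
    simp only [DiaFm.toFm, KripkeModel.V]
    rw [gimp_eq_one.2 unitInterval.nonneg', gimp_eq_one.2 unitInterval.le_one', min_self]
  | A14 A B =>
    simp only [DiaFm.toFm, KripkeModel.V]
    rcases le_total (K.V A.toFm x) (K.V B.toFm x) with h | h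
    · rw [gimp_eq_one.2 h]
      exact max_eq_left unitInterval.le_one'
    · rw [gimp_eq_one.2 h]
      exact max_eq_right unitInterval.le_one'
  | A10 A B C =>
    simp only [DiaFm.toFm, KripkeModel.V, gimp_eq_one, le_gimp_iff]
    rcases le_total (K.V A.toFm x) (K.V B.toFm x) with h | h
    · rw [max_eq_right h]
      exact (min_le_min_right _ (min_le_right _ _)).trans (le_gimp_iff.1 le_rfl)
    · rw [max_eq_left h]
      exact (min_le_min_right _ (min_le_left _ _)).trans (le_gimp_iff.1 le_rfl)
  | _ =>
    simp only [DiaFm.toFm, KripkeModel.V, gimp_eq_one, le_gimp_iff]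
    grind [gimp, unitInterval.le_one']

theorem gimp_zero (x : unitInterval) : gimp x 0 = if x = 0 then 1 else 0 := by
  unfold gimp
  by_cases h : x = 0
  · simp [h]
  · simp [h, unitInterval.pos_iff_ne_zero]

theorem DiaAxiom.sound {A : DiaFm} (h : DiaAxiom A) (K : KripkeModel.{u}) (x : K.W) :
    K.V A.toFm x = 1 := by
  cases h with
  | K A B =>
    simp only [DiaFm.toFm, KripkeModel.V, gimp_eq_one]
    refine iSup_le fun y => ?_
    rw [min_max_distrib_right]
    exact max_le_max (le_iSup (fun y => min (K.V A.toFm y) (K.R x y)) y)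
      (le_iSup (fun y => min (K.V B.toFm y) (K.R x y)) y)
  | Z A =>
    simp only [DiaFm.toFm, DiaFm.neg, KripkeModel.V, gimp_eq_one]
    refine iSup_le fun y => ?_
    by_cases h : (⨆ y : K.W, min (K.V A.toFm y) (K.R x y)) = 0
    · have hy : min (K.V A.toFm y) (K.R x y) = 0 :=
        le_antisymm ((le_iSup (fun y => min (K.V A.toFm y) (K.R x y)) y).trans h.le)
          unitInterval.nonneg'
      rcases min_eq_iff.1 hy with h1 | h1
      · rw [h1.1, gimp_zero 0, if_pos rfl, gimp_zero 1, if_neg one_ne_zero]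
        exact (min_le_left _ _).trans unitInterval.nonneg'
      · rw [h1.1]
        exact (min_le_right _ _).trans unitInterval.nonneg'
    · rw [gimp_zero (⨆ _, _), if_neg h, gimp_zero 0, if_pos rfl]
      exact unitInterval.le_one'
  | F =>
    simp only [DiaFm.toFm, DiaFm.neg, KripkeModel.V, gimp_eq_one]
    exact iSup_le fun y => min_le_left _ _

theorem validates_mp {K : KripkeModel.{u}} {A B : DiaFm} (hA : K.Validates A.toFm)
    (hAB : K.Validates (DiaFm.imp A B).toFm) : K.Validates B.toFm := by
  intro x
  have h := hAB x
  simp only [DiaFm.toFm, KripkeModel.V, gimp_eq_one, hA x] at h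
  exact le_antisymm unitInterval.le_one' h

theorem HGKFDia.sound {A : DiaFm} (h : HGKFDia A) (K : KripkeModel.{u}) :
    K.Validates A.toFm := by
  induction h with
  | hg h => exact h.sound K
  | modal h => exact h.sound K
  | mp _ _ hA hAB => exact validates_mp hA hAB
  | nec _ ih =>
    intro x
    simp only [DiaFm.toFm, KripkeModel.V, gimp_eq_one]
    refine iSup_mono fun y => min_le_min_right _ ?_
    simpa only [DiaFm.toFm, KripkeModel.V, gimp_eq_one] using ih y

theorem HGKDia.sound {A : DiaFm} (h : HGKDia A) (K : KripkeModel.{u}) (hK : K.IsCrisp) :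
    K.Validates A.toFm := by
  induction h with
  | hg h => exact h.sound K
  | modal h => exact h.sound K
  | mp _ _ hA hAB => exact validates_mp hA hAB
  | @nec A B C _ ih =>
    intro x
    simp only [KripkeModel.Validates, DiaFm.toFm, KripkeModel.V] at ih ⊢
    -- Either a successor gives `C` value 1, so `◇C` has value 1, or the premise forces `A → B` to
    -- be 1 at every successor. Crispness makes the two cases exhaustive.
    by_cases hC : ∃ y, K.R x y = 1 ∧ K.V C.toFm y = 1
    · obtain ⟨y, hR, hy⟩ := hC
      refine le_antisymm unitInterval.le_one' (le_max_of_le_right ?_)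
      refine le_iSup_of_le y ?_
      rw [hR, hy, min_self]
    · refine le_antisymm unitInterval.le_one' (le_max_of_le_left ?_)
      refine (gimp_eq_one.2 (iSup_mono fun y => ?_)).ge
      rcases hK x y with hR | hR
      · rw [hR]
        exact (min_le_right _ _).trans unitInterval.nonneg'
      · refine min_le_min_right _ (gimp_eq_one.1 ?_)
        rcases max_choice (gimp (K.V A.toFm y) (K.V B.toFm y)) (K.V C.toFm y) with h | h
        · rw [← h]
          exact ih y
        · exact absurd ⟨y, hR, h ▸ ih y⟩ hC

/-! ### Theories and Gödel valuations -/

/-- A set of formulas containing the axioms of `HG` and closed under modus ponens. -/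
structure IsTheory (T : Set DiaFm) : Prop where
  ax {A : DiaFm} : HGAxiom A → A ∈ T
  mp {A B : DiaFm} : A ∈ T → DiaFm.imp A B ∈ T → B ∈ T

namespace IsTheory

variable {T : Set DiaFm} {A B C D : DiaFm}

theorem weaken (hT : IsTheory T) (h : B ∈ T) : DiaFm.imp A B ∈ T :=
  hT.mp h (hT.ax (.A1 B A))

theorem id (hT : IsTheory T) : DiaFm.imp A A ∈ T :=
  hT.mp (hT.ax (.A1 A A)) (hT.ax (.A13 A A))

theorem trans (hT : IsTheory T) (h : DiaFm.imp A B ∈ T) (h' : DiaFm.imp B C ∈ T) :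
    DiaFm.imp A C ∈ T :=
  hT.mp h (hT.mp h' (hT.ax (.A8 B C A)))

theorem mp_under (hT : IsTheory T) (h : DiaFm.imp D A ∈ T)
    (h' : DiaFm.imp D (.imp A B) ∈ T) : DiaFm.imp D B ∈ T :=
  hT.mp (hT.trans h (hT.mp h' (hT.ax (.A9 D A B)))) (hT.ax (.A13 D B))

theorem and_intro (hT : IsTheory T) (h : A ∈ T) (h' : B ∈ T) : DiaFm.and A B ∈ T :=
  hT.mp h' (hT.mp h (hT.ax (.A4 A B)))

theorem imp_and (hT : IsTheory T) (h : DiaFm.imp C A ∈ T) (h' : DiaFm.imp C B ∈ T) :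
    DiaFm.imp C (.and A B) ∈ T :=
  hT.mp (hT.and_intro h h') (hT.ax (.A12 A B C))

theorem or_imp (hT : IsTheory T) (h : DiaFm.imp A C ∈ T) (h' : DiaFm.imp B C ∈ T) :
    DiaFm.imp (.or A B) C ∈ T :=
  hT.mp (hT.and_intro h h') (hT.ax (.A10 A B C))

theorem or_imp_or (hT : IsTheory T) {A' B' : DiaFm} (h : DiaFm.imp A A' ∈ T)
    (h' : DiaFm.imp B B' ∈ T) : DiaFm.imp (.or A B) (.or A' B') ∈ T :=
  hT.or_imp (hT.trans h (hT.ax (.A6 _ _))) (hT.trans h' (hT.ax (.A7 _ _)))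

theorem bot_imp (hT : IsTheory T) : DiaFm.imp .bot A ∈ T :=
  hT.mp (hT.ax (.A5 A)) (hT.ax (.A2 _ _))

theorem imp_top (hT : IsTheory T) : DiaFm.imp A .top ∈ T :=
  hT.mp (hT.ax (.A5 A)) (hT.ax (.A3 _ _))

theorem top_mem (hT : IsTheory T) : DiaFm.top ∈ T :=
  hT.mp (hT.ax (.A1 .bot .bot)) hT.imp_top

/-- The consequences of `A` over `T`. -/
theorem extend (hT : IsTheory T) (A : DiaFm) : IsTheory {B | DiaFm.imp A B ∈ T} where
  ax h := hT.weaken (hT.ax h)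
  mp h h' := hT.mp_under h h'

/-- A theory disjoint from a directed set of formulas extends to a linear theory
disjoint from that set. -/
theorem exists_linear (hT : IsTheory T) (J : Set DiaFm)
    (hJ : ∀ X ∈ J, ∀ Y ∈ J, ∃ Z ∈ J, DiaFm.imp X Z ∈ T ∧ DiaFm.imp Y Z ∈ T)
    (hdisj : Disjoint T J) :
    ∃ T' : Set DiaFm, IsTheory T' ∧ T ⊆ T' ∧ Disjoint T' J ∧
      ∀ X Y, DiaFm.imp X Y ∈ T' ∨ DiaFm.imp Y X ∈ T' := by
  obtain ⟨M, hTM, hM⟩ := zorn_subset_nonempty {T' | IsTheory T' ∧ Disjoint T' J} (by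
    intro c hc hchain hne
    refine ⟨⋃₀ c, ⟨⟨fun h => ?_, ?_⟩, ?_⟩, fun s hs => Set.subset_sUnion_of_mem hs⟩
    · obtain ⟨s, hs⟩ := hne
      exact ⟨s, hs, (hc hs).1.ax h⟩
    · rintro A B ⟨s, hs, hA⟩ ⟨t, ht, hAB⟩
      rcases hchain.total hs ht with h | h
      · exact ⟨t, ht, (hc ht).1.mp (h hA) hAB⟩
      · exact ⟨s, hs, (hc hs).1.mp hA (h hAB)⟩
    · exact Set.disjoint_sUnion_left.2 fun s hs => (hc hs).2) T ⟨hT, hdisj⟩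
  obtain ⟨hMT, hMJ⟩ := hM.prop
  refine ⟨M, hMT, hTM, hMJ, fun X Y => ?_⟩
  -- By maximality, the consequences of `Z` over `M` must meet `J`.
  have key : ∀ Z, Z ∉ M → ∃ j ∈ J, DiaFm.imp Z j ∈ M := by
    intro Z hZ
    by_contra! hcon
    refine hZ (hM.le_of_ge (y := {B | DiaFm.imp Z B ∈ M}) ⟨hMT.extend Z, ?_⟩
      (fun B hB => hMT.weaken hB) hMT.id)
    exact Set.disjoint_left.2 fun B hB hBJ => hcon B hBJ hB
  by_contra! hcon
  obtain ⟨j, hj, h1⟩ := key _ hcon.1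
  obtain ⟨k, hk, h2⟩ := key _ hcon.2
  obtain ⟨l, hl, hjl, hkl⟩ := hJ j hj k hk
  refine Set.disjoint_left.1 hMJ ?_ hl
  exact hMT.mp (hMT.ax (.A14 X Y))
    (hMT.or_imp (hMT.trans h1 (hTM hjl)) (hMT.trans h2 (hTM hkl)))

end IsTheory

/-- An injective numbering of the formulas of the diamond language. -/
def DiaFm.code : DiaFm → ℕ
  | .var p => Nat.pair 0 p
  | .bot => Nat.pair 1 0
  | .top => Nat.pair 2 0
  | .imp A B => Nat.pair 3 (Nat.pair A.code B.code)
  | .and A B => Nat.pair 4 (Nat.pair A.code B.code)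
  | .or A B => Nat.pair 5 (Nat.pair A.code B.code)
  | .dia A => Nat.pair 6 A.code

theorem DiaFm.code_injective : Function.Injective DiaFm.code := by
  intro A
  induction A with
  | var p => intro B h; cases B <;> simp_all [code, Nat.pair_eq_pair]
  | bot => intro B h; cases B <;> simp_all [code, Nat.pair_eq_pair]
  | top => intro B h; cases B <;> simp_all [code, Nat.pair_eq_pair]
  | imp A₁ A₂ ih₁ ih₂ =>
    intro B h
    cases B <;> simp only [code, Nat.pair_eq_pair] at h <;> grind
  | and A₁ A₂ ih₁ ih₂ =>
    intro B h
    cases B <;> simp only [code, Nat.pair_eq_pair] at h <;> grind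
  | or A₁ A₂ ih₁ ih₂ =>
    intro B h
    cases B <;> simp only [code, Nat.pair_eq_pair] at h <;> grind
  | dia A ih =>
    intro B h
    cases B <;> simp only [code, Nat.pair_eq_pair] at h <;> grind

instance : Countable DiaFm := DiaFm.code_injective.countable

/-- A total preorder on a countable type is represented by a rational-valued function. -/
theorem exists_rat_representation {α : Type*} [Countable α] (r : α → α → Prop)
    (hrefl : ∀ a, r a a) (htrans : ∀ a b c, r a b → r b c → r a c)
    (htotal : ∀ a b, r a b ∨ r b a) : ∃ f : α → ℚ, ∀ a b, f a ≤ f b ↔ r a b := by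
  classical
  let : Preorder α := { le := r, le_refl := hrefl, le_trans := htrans }
  have : Std.Total (α := α) (· ≤ ·) := ⟨htotal⟩
  have : Countable (Antisymmetrization α (· ≤ ·)) :=
    inferInstanceAs (Countable (Quotient _))
  obtain ⟨e⟩ := Order.embedding_from_countable_to_dense (Antisymmetrization α (· ≤ ·)) ℚ
  exact ⟨fun a => e (toAntisymmetrization (· ≤ ·) a), fun a b =>
    e.le_iff_le.trans toAntisymmetrization_le_toAntisymmetrization_iff⟩

/-- A `[0,1]`-valued Gödel valuation of all formulas, treating formulas `◇A` as atoms. -/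
structure IsValuation (w : DiaFm → unitInterval) : Prop where
  bot : w .bot = 0
  top : w .top = 1
  imp (A B : DiaFm) : w (.imp A B) = gimp (w A) (w B)
  and (A B : DiaFm) : w (.and A B) = min (w A) (w B)
  or (A B : DiaFm) : w (.or A B) = max (w A) (w B)

theorem gimp_comp {g : unitInterval → unitInterval} (hg : StrictMono g) (h1 : g 1 = 1)
    (x y : unitInterval) : g (gimp x y) = gimp (g x) (g y) := by
  unfold gimp
  simp only [hg.lt_iff_lt]
  split_ifs
  · rfl
  · exact h1

theorem IsValuation.comp {w : DiaFm → unitInterval} (hw : IsValuation w)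
    {g : unitInterval → unitInterval} (hg : StrictMono g) (h0 : g 0 = 0) (h1 : g 1 = 1) :
    IsValuation (g ∘ w) where
  bot := by simp [hw.bot, h0]
  top := by simp [hw.top, h1]
  imp A B := by simp [hw.imp, gimp_comp hg h1]
  and A B := by simp [hw.and, hg.monotone.map_min]
  or A B := by simp [hw.or, hg.monotone.map_max]

/-- A consistent linear theory is represented by a Gödel valuation. -/
theorem IsTheory.exists_valuation_of_linear {T : Set DiaFm} (hT : IsTheory T)
    (hbot : DiaFm.bot ∉ T) (hlin : ∀ X Y, DiaFm.imp X Y ∈ T ∨ DiaFm.imp Y X ∈ T) :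
    ∃ w, IsValuation w ∧ ∀ A, w A = 1 ↔ A ∈ T := by
  obtain ⟨f, hf⟩ := exists_rat_representation (fun X Y => DiaFm.imp X Y ∈ T)
    (fun _ => hT.id) (fun _ _ _ => hT.trans) hlin
  have hlt : f .bot < f .top := by
    rw [← not_le, hf]
    exact fun h => hbot (hT.mp hT.top_mem h)
  have hpos : (0 : ℝ) < f .top - f .bot := by
    have : (f .bot : ℝ) < f .top := by exact_mod_cast hlt
    linarith
  have hbound : ∀ X, (f .bot : ℝ) ≤ f X ∧ (f X : ℝ) ≤ f .top := fun X =>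
    ⟨by exact_mod_cast (hf _ _).2 hT.bot_imp, by exact_mod_cast (hf _ _).2 hT.imp_top⟩
  -- Affine normalization: `⊥` goes to 0 and `⊤` to 1.
  let w : DiaFm → unitInterval := fun X => ⟨(f X - f .bot) / (f .top - f .bot),
    div_nonneg (by linarith [(hbound X).1]) hpos.le,
    (div_le_one hpos).2 (by linarith [(hbound X).2])⟩
  have hw : ∀ X Y, w X ≤ w Y ↔ DiaFm.imp X Y ∈ T := by
    intro X Y
    rw [← hf, ← Subtype.coe_le_coe]
    simp only [w]
    rw [div_le_div_iff_of_pos_right hpos, sub_le_sub_iff_right, Rat.cast_le]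
  have htop : w .top = 1 := Subtype.ext (by simp [w, div_self hpos.ne'])
  have hmem : ∀ A, w A = 1 ↔ A ∈ T := by
    intro A
    refine ⟨fun h => hT.mp hT.top_mem ((hw _ _).1 (by rw [h, htop])), fun h => ?_⟩
    exact le_antisymm unitInterval.le_one' (htop ▸ (hw _ _).2 (hT.weaken h))
  refine ⟨w, ⟨Subtype.ext (by simp [w]), htop, fun A B => ?_, fun A B => ?_, fun A B => ?_⟩,
    hmem⟩
  · unfold gimp
    split_ifs with h
    · have hAB : DiaFm.imp A B ∉ T := fun h' => not_le.2 h ((hw _ _).2 h')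
      refine le_antisymm ((hw _ _).2 ?_) ((hw _ _).2 (hT.ax (.A1 B A)))
      -- Contraction excludes the first case; in the second, `A → B` implies `A`, hence `B`.
      rcases hlin A (.imp A B) with h' | h'
      · exact absurd (hT.mp h' (hT.ax (.A13 A B))) hAB
      · exact hT.mp_under h' hT.id
    · exact (hmem _).2 ((hw _ _).1 (not_lt.1 h))
  · refine le_antisymm (le_min ((hw _ _).2 (hT.ax (.A2 A B))) ((hw _ _).2 (hT.ax (.A3 A B)))) ?_
    rcases hlin A B with h | h
    · exact (min_le_left _ _).trans ((hw _ _).2 (hT.imp_and hT.id h))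
    · exact (min_le_right _ _).trans ((hw _ _).2 (hT.imp_and h hT.id))
  · refine le_antisymm ?_ (max_le ((hw _ _).2 (hT.ax (.A6 A B))) ((hw _ _).2 (hT.ax (.A7 A B))))
    rcases hlin A B with h | h
    · exact ((hw _ _).2 (hT.or_imp h hT.id)).trans (le_max_right _ _)
    · exact ((hw _ _).2 (hT.or_imp hT.id h)).trans (le_max_left _ _)

/-- The Gödel valuations satisfying every formula of `T`. -/
def valuations (T : Set DiaFm) : Set (DiaFm → unitInterval) :=
  {w | IsValuation w ∧ ∀ A ∈ T, w A = 1}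

theorem le_of_mem_valuations {T : Set DiaFm} {w : DiaFm → unitInterval}
    (hw : w ∈ valuations T) {A B : DiaFm} (h : DiaFm.imp A B ∈ T) : w A ≤ w B := by
  rw [← gimp_eq_one, ← hw.1.imp]
  exact hw.2 _ h

/-- Directed, nonempty sets of formulas modulo provable implication in `T`. -/
structure IsDirectedIn (T P : Set DiaFm) : Prop where
  nonempty : P.Nonempty
  directed : ∀ X ∈ P, ∀ Y ∈ P, ∃ Z ∈ P, DiaFm.imp X Z ∈ T ∧ DiaFm.imp Y Z ∈ T

theorem IsDirectedIn.singleton {T : Set DiaFm} (hT : IsTheory T) (A : DiaFm) :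
    IsDirectedIn T {A} :=
  ⟨⟨A, rfl⟩, by rintro X rfl Y rfl; exact ⟨_, rfl, hT.id, hT.id⟩⟩

theorem IsTheory.exists_valuation {T : Set DiaFm} (hT : IsTheory T) {J : Set DiaFm}
    (hJ : IsDirectedIn T J) (hdisj : Disjoint T J) :
    ∃ w ∈ valuations T, ∀ B ∈ J, w B < 1 := by
  obtain ⟨T', hT', hsub, hdisj', hlin⟩ := hT.exists_linear J hJ.directed hdisj
  have hbot : DiaFm.bot ∉ T' := by
    obtain ⟨j, hj⟩ := hJ.nonempty
    exact fun h => Set.disjoint_left.1 hdisj' (hT'.mp h hT'.bot_imp) hj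
  obtain ⟨w, hw, hmem⟩ := hT'.exists_valuation_of_linear hbot hlin
  refine ⟨w, ⟨hw, fun A hA => (hmem A).2 (hsub hA)⟩, fun B hB => ?_⟩
  refine lt_of_le_of_ne unitInterval.le_one' fun h => ?_
  exact Set.disjoint_left.1 hdisj' ((hmem B).1 h) hB

/-- The disjunctions `(A → B) ∨ C` form a directed set because `P` and `Q` are directed, so one
valuation keeps all of them below 1. Each then has both disjuncts below 1. -/
theorem IsTheory.exists_valuation_lt {T : Set DiaFm} (hT : IsTheory T) {P Q : Set DiaFm}
    (hP : IsDirectedIn T P) (hQ : IsDirectedIn T Q) (A : DiaFm)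
    (h : ∀ B ∈ P, ∀ C ∈ Q, DiaFm.or (.imp A B) C ∉ T) :
    ∃ w ∈ valuations T, (∀ B ∈ P, w B < w A) ∧ ∀ C ∈ Q, w C < 1 := by
  obtain ⟨w, hw, hJ⟩ := hT.exists_valuation
    (J := {Z | ∃ B ∈ P, ∃ C ∈ Q, Z = DiaFm.or (.imp A B) C})
    ⟨by
      obtain ⟨B, hB⟩ := hP.nonempty
      obtain ⟨C, hC⟩ := hQ.nonempty
      exact ⟨_, B, hB, C, hC, rfl⟩, by
      rintro _ ⟨B, hB, C, hC, rfl⟩ _ ⟨B', hB', C', hC', rfl⟩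
      obtain ⟨E, hE, hBE, hBE'⟩ := hP.directed B hB B' hB'
      obtain ⟨F, hF, hCF, hCF'⟩ := hQ.directed C hC C' hC'
      exact ⟨_, ⟨E, hE, F, hF, rfl⟩,
        hT.or_imp_or (hT.mp hBE (hT.ax (.A8 _ _ _))) hCF,
        hT.or_imp_or (hT.mp hBE' (hT.ax (.A8 _ _ _))) hCF'⟩⟩
    (Set.disjoint_left.2 (by rintro _ hZ ⟨B, hB, C, hC, rfl⟩; exact h B hB C hC hZ))
  have hlt : ∀ B ∈ P, ∀ C ∈ Q, gimp (w A) (w B) < 1 ∧ w C < 1 := by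
    intro B hB C hC
    have := hJ _ ⟨B, hB, C, hC, rfl⟩
    rwa [hw.1.or, hw.1.imp, max_lt_iff] at this
  refine ⟨w, hw, fun B hB => ?_, fun C hC => ?_⟩
  · obtain ⟨C, hC⟩ := hQ.nonempty
    exact not_le.1 fun h => (hlt B hB C hC).1.ne (gimp_eq_one.2 h)
  · obtain ⟨B, hB⟩ := hP.nonempty
    exact (hlt B hB C hC).2

/-! ### Rescaling valuations -/

/-- Piecewise linear with upward jumps: values below `a` are squeezed under `m`, those from `a` up
to 1 are moved into `[d, c)`, and 1 stays fixed. -/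
theorem exists_rescaling {a m d c : unitInterval} (ha : 0 < a) (hm : 0 < m) (hd : 0 < d)
    (hdc : d < c) :
    ∃ g : unitInterval → unitInterval, StrictMono g ∧ g 0 = 0 ∧ g 1 = 1 ∧ d ≤ g a ∧
      (∀ x < 1, g x < c) ∧ ∀ x < a, x < 1 → g x ≤ m := by
  classical
  -- The slope below `a`: at most `m` for the last bound, at most `d` for monotonicity across `a`.
  have hk : 0 < min m d := lt_min hm hd
  set k : unitInterval := min m d
  have hkd : k ≤ d := min_le_right _ _
  have hkm : k ≤ m := min_le_left _ _
  simp only [← Subtype.coe_lt_coe, ← Subtype.coe_le_coe, Set.Icc.coe_zero] at ha hk hkd hkm hdc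
  have hd0 := d.2.1
  have hc1 := c.2.2
  let g : unitInterval → ℝ := fun x =>
    if x = 1 then 1 else if x < a then k * x else d + (c - d) * x
  have hmid : ∀ x : unitInterval, x < 1 → (k : ℝ) * x < k ∧ (d : ℝ) + (c - d) * x < c := by
    intro x hx
    have hx' : (x : ℝ) < 1 := hx
    exact ⟨by nlinarith, by nlinarith⟩
  have hge : ∀ x : unitInterval, (0 : ℝ) ≤ k * x ∧ (d : ℝ) ≤ d + (c - d) * x := by
    intro x
    have := x.2.1
    exact ⟨by positivity, by nlinarith⟩
  have hltc : ∀ x < 1, g x < c := by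
    intro x hx
    simp only [g, if_neg hx.ne]
    split_ifs
    · linarith [(hmid x hx).1]
    · exact (hmid x hx).2
  have hmem : ∀ x, g x ∈ Set.Icc (0 : ℝ) 1 := by
    intro x
    rcases eq_or_lt_of_le (unitInterval.le_one' (t := x)) with h | h
    · simp [g, h]
    · refine ⟨?_, (hltc x h).le.trans hc1⟩
      simp only [g, if_neg h.ne]
      split_ifs
      · exact (hge x).1
      · exact hd0.trans (hge x).2
  refine ⟨fun x => ⟨g x, hmem x⟩, ?_, ?_, ?_, ?_, fun x hx => hltc x hx, ?_⟩
  · intro x y hxy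
    have hxy' : (x : ℝ) < y := hxy
    have hx1 : x < 1 := hxy.trans_le unitInterval.le_one'
    change g x < g y
    by_cases hy1 : y = 1
    · have : g y = 1 := by simp [g, hy1]
      rw [this]
      exact (hltc x hx1).trans_le hc1
    · simp only [g, if_neg hx1.ne, if_neg hy1]
      split_ifs with h1 h2 h2
      · nlinarith
      · linarith [(hmid x hx1).1, (hge y).2]
      · exact absurd (hxy.trans h2) h1
      · nlinarith
  · refine Subtype.ext ?_
    have : (0 : unitInterval) < a := ha
    simp [g, this]
  · exact Subtype.ext (by simp [g])
  · change (d : ℝ) ≤ g a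
    simp only [g, lt_irrefl, if_false]
    split_ifs
    · exact d.2.2
    · exact (hge a).2
  · intro x hx hx1
    change g x ≤ m
    simp only [g, if_neg hx1.ne, if_pos hx]
    exact (hmid x hx1).1.le.trans hkm

theorem exists_pos_le_of_finite {α : Type*} {S : Set α} (hS : S.Finite)
    (f : α → unitInterval) : ∃ m, 0 < m ∧ ∀ a ∈ S, f a ≠ 0 → m ≤ f a := by
  induction S, hS using Set.Finite.induction_on with
  | empty => exact ⟨1, one_pos, by simp⟩
  | @insert a S _ _ ih =>
    obtain ⟨m, hm, h⟩ := ih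
    by_cases ha : f a = 0
    · refine ⟨m, hm, ?_⟩
      rintro b (rfl | hb) hb0
      · exact absurd ha hb0
      · exact h b hb hb0
    · refine ⟨min m (f a), lt_min hm (unitInterval.pos_iff_ne_zero.2 ha), ?_⟩
      rintro b (rfl | hb) hb0
      · exact min_le_right _ _
      · exact (min_le_left _ _).trans (h b hb hb0)

/-! ### Canonical models -/

/-- A theory of Gödel logic containing the diamond axioms. -/
structure IsDiaTheory (T : Set DiaFm) : Prop extends IsTheory T where
  modal {A : DiaFm} : DiaAxiom A → A ∈ T

/-- `F` puts `⊥` in the set and `K` closes it under disjunction. -/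
theorem IsDiaTheory.isDirectedIn_lt {T : Set DiaFm} (hT : IsDiaTheory T)
    {v : DiaFm → unitInterval} (hv : v ∈ valuations T) {c : unitInterval} (hc : 0 < c) :
    IsDirectedIn T {B | v (.dia B) < c} := by
  refine ⟨⟨.bot, ?_⟩, fun X hX Y hY =>
    ⟨.or X Y, ?_, hT.ax (.A6 X Y), hT.ax (.A7 X Y)⟩⟩
  · have h := le_of_mem_valuations hv (hT.modal .F)
    rw [hv.1.bot] at h
    exact h.trans_lt hc
  · have h := le_of_mem_valuations hv (hT.modal (.K X Y))
    rw [hv.1.or] at h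
    exact h.trans_lt (max_lt hX hY)

/-- Finiteness of `S` gives a positive lower bound `m` for the nonzero `v (◇B)`, under which
rescaling can push all values below `w A`. Formulas with `v (◇B) = 0` must already vanish, which is
what `Z` provides. -/
theorem IsDiaTheory.exists_witness {T : Set DiaFm} (hT : IsDiaTheory T)
    {v : DiaFm → unitInterval} (hv : v ∈ valuations T) {S : Set DiaFm} (hS : S.Finite)
    {A : DiaFm} {d : unitInterval} (hd : 0 < d) (hdA : d < v (.dia A)) {Q : Set DiaFm}
    (hQ : IsDirectedIn T Q)
    (h : ∀ B, v (.dia B) < v (.dia A) → ∀ C ∈ Q, DiaFm.or (.imp A B) C ∉ T) :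
    ∃ w ∈ valuations T, d ≤ w A ∧ (∀ B ∈ S, v (.dia B) < v (.dia A) → w B ≤ v (.dia B)) ∧
      ∀ C ∈ Q, w C < v (.dia A) := by
  have hc : 0 < v (.dia A) := hd.trans hdA
  obtain ⟨w, hw, hP, hQ'⟩ := hT.exists_valuation_lt (hT.isDirectedIn_lt hv hc) hQ A h
  have ha : 0 < w A := by
    obtain ⟨B, hB⟩ := (hT.isDirectedIn_lt hv hc).nonempty
    exact unitInterval.nonneg'.trans_lt (hP B hB)
  obtain ⟨m, hm, hmS⟩ := exists_pos_le_of_finite hS fun B => v (.dia B)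
  obtain ⟨g, hg, hg0, hg1, hga, hgc, hgm⟩ := exists_rescaling ha hm hd hdA
  refine ⟨g ∘ w, ⟨hw.1.comp hg hg0 hg1, fun B hB => by simp [hw.2 B hB, hg1]⟩, hga,
    fun B hB hlt => ?_, fun C hC => hgc _ (hQ' C hC)⟩
  by_cases hB0 : v (.dia B) = 0
  · have hZ := le_of_mem_valuations hv (hT.modal (.Z B))
    have h0 : v (.dia B.neg.neg) = 0 := by
      refine le_antisymm (hZ.trans ?_) unitInterval.nonneg'
      rw [DiaFm.neg, hv.1.imp, DiaFm.neg, hv.1.imp, hv.1.bot, hB0, gimp_zero 0, if_pos rfl,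
        gimp_zero, if_neg one_ne_zero]
    -- A double negation takes only the values 0 and 1, so being below `w A` makes it 0.
    have h1 : w B.neg.neg < w A := hP _ (by rw [Set.mem_ofPred_eq, h0]; exact hc)
    have hwB : w B = 0 := by
      by_contra hne
      rw [DiaFm.neg, hw.1.imp, DiaFm.neg, hw.1.imp, hw.1.bot, gimp_zero (w B), if_neg hne,
        gimp_zero 0, if_pos rfl] at h1
      exact absurd h1 (not_lt.2 unitInterval.le_one')
    rw [Function.comp_apply, hwB, hg0]
    exact unitInterval.nonneg'
  · have hlt' : w B < w A := hP B hlt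
    exact (hgm _ hlt' (hlt'.trans_le unitInterval.le_one')).trans (hmS B hB hB0)

/-- The model whose worlds are the Gödel valuations satisfying `T`. -/
def canonicalModel (T : Set DiaFm) (hne : (valuations T).Nonempty)
    (R : (DiaFm → unitInterval) → (DiaFm → unitInterval) → unitInterval) :
    KripkeModel.{u} where
  W := ULift.{u} (valuations T)
  nonempty := ⟨⟨⟨hne.some, hne.some_mem⟩⟩⟩
  R v w := R v.down.1 w.down.1
  val p w := w.down.1 (.var p)

/-- The formulas `A` such that `◇A` is a subformula of the given formula. -/
def DiaFm.args : DiaFm → Set DiaFm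
  | .var _ => ∅
  | .bot => ∅
  | .top => ∅
  | .imp A B => A.args ∪ B.args
  | .and A B => A.args ∪ B.args
  | .or A B => A.args ∪ B.args
  | .dia A => insert A A.args

theorem DiaFm.finite_args (A : DiaFm) : A.args.Finite := by
  induction A with
  | var | bot | top => exact Set.finite_empty
  | imp A B hA hB => exact hA.union hB
  | and A B hA hB => exact hA.union hB
  | or A B hA hB => exact hA.union hB
  | dia A hA => exact hA.insert A

/-- Truth lemma. The supremum for `◇A` need not be attained, so `hex` asks only for approximations
from below and density of `[0,1]` does the rest. -/
theorem canonicalModel_V {T : Set DiaFm} (hne : (valuations T).Nonempty)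
    {R : (DiaFm → unitInterval) → (DiaFm → unitInterval) → unitInterval} {S : Set DiaFm}
    (hle : ∀ v ∈ valuations T, ∀ w ∈ valuations T, ∀ B ∈ S, min (w B) (R v w) ≤ v (.dia B))
    (hex : ∀ v ∈ valuations T, ∀ A ∈ S, ∀ d, 0 < d → d < v (.dia A) →
      ∃ w ∈ valuations T, d ≤ min (w A) (R v w))
    {A : DiaFm} (hA : A.args ⊆ S) (v : (canonicalModel.{u} T hne R).W) :
    (canonicalModel.{u} T hne R).V A.toFm v = v.down.1 A := by
  induction A generalizing v with
  | var p => rfl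
  | bot => exact v.down.2.1.bot.symm
  | top => exact v.down.2.1.top.symm
  | imp A B ihA ihB =>
    obtain ⟨hA, hB⟩ := Set.union_subset_iff.1 hA
    rw [DiaFm.toFm, KripkeModel.V, ihA hA, ihB hB, v.down.2.1.imp]
  | and A B ihA ihB =>
    obtain ⟨hA, hB⟩ := Set.union_subset_iff.1 hA
    rw [DiaFm.toFm, KripkeModel.V, ihA hA, ihB hB, v.down.2.1.and]
  | or A B ihA ihB =>
    obtain ⟨hA, hB⟩ := Set.union_subset_iff.1 hA
    rw [DiaFm.toFm, KripkeModel.V, ihA hA, ihB hB, v.down.2.1.or]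
  | dia A ih =>
    obtain ⟨hAS, hA⟩ := Set.insert_subset_iff.1 hA
    rw [DiaFm.toFm, KripkeModel.V]
    simp only [ih hA]
    refine le_antisymm (iSup_le fun w => hle _ v.down.2 _ w.down.2 A hAS) ?_
    refine le_of_forall_lt_imp_le_of_dense fun e he => ?_
    obtain ⟨d, hed, hd⟩ := exists_between he
    obtain ⟨w, hw, hwd⟩ := hex _ v.down.2 A hAS d (unitInterval.nonneg'.trans_lt hed) hd
    exact (hed.le.trans hwd).trans (le_iSup
      (fun w : (canonicalModel.{u} T hne R).W => min (w.down.1 A) (R v.down.1 w.down.1))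
      ⟨⟨w, hw⟩⟩)

/-! ### Completeness of the two systems. -/

theorem HGKFDia.isDiaTheory : IsDiaTheory {A | HGKFDia A} where
  ax h := .hg h
  mp h h' := .mp h h'
  modal h := .modal h

theorem HGKDia.isDiaTheory : IsDiaTheory {A | HGKDia A} where
  ax h := .hg h
  mp h h' := .mp h h'
  modal h := .modal h

theorem HGKFDia.complete {A : DiaFm} (h : GKFValid.{u} A.toFm) : HGKFDia A := by
  by_contra hA
  have hT := HGKFDia.isDiaTheory
  obtain ⟨v, hv, hvA⟩ := hT.exists_valuation (.singleton hT.toIsTheory A)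
    (Set.disjoint_singleton_right.2 hA)
  let R (v w : DiaFm → unitInterval) : unitInterval :=
    ⨅ B : A.args, gimp (w B) (v (.dia B))
  have key := canonicalModel_V.{u} (R := R) ⟨v, hv⟩
    (fun v _ w _ B hB => by
      rw [min_comm]
      exact le_gimp_iff.1 (iInf_le (fun B : A.args => gimp (w B) (v (.dia B))) ⟨B, hB⟩))
    (fun v hv B _ d hd hdB => by
      obtain ⟨w, hw, hwB, hwS, _⟩ := hT.exists_witness hv A.finite_args hd hdB
        -- With `Q = {⊥}` the side disjunct disappears, so the plain rule suffices.
        (.singleton hT.toIsTheory .bot) (by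
          rintro C hC _ rfl hmem
          have hBC : HGKFDia (.imp B C) := hT.mp hmem (hT.or_imp hT.id hT.bot_imp)
          exact not_le.2 hC (le_of_mem_valuations hv hBC.nec))
      refine ⟨w, hw, le_min hwB (le_iInf fun C => ?_)⟩
      -- If `v (◇C) ≥ v (◇B)`, the residuum is at least `v (◇C) > d`, whatever `w C` is.
      rcases lt_or_ge (v (.dia C)) (v (.dia B)) with hC | hC
      · rw [gimp_eq_one.2 (hwS C C.2 hC)]
        exact unitInterval.le_one'
      · exact (hdB.le.trans hC).trans (le_gimp _ _))
    (subset_refl A.args) ⟨⟨v, hv⟩⟩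
  exact (hvA A rfl).ne (key.symm.trans (h _ _))

theorem HGKDia.complete {A : DiaFm} (h : GKValid.{u} A.toFm) : HGKDia A := by
  classical
  by_contra hA
  have hT := HGKDia.isDiaTheory
  obtain ⟨v, hv, hvA⟩ := hT.exists_valuation (.singleton hT.toIsTheory A)
    (Set.disjoint_singleton_right.2 hA)
  let R (v w : DiaFm → unitInterval) : unitInterval :=
    if ∀ B ∈ A.args, w B ≤ v (.dia B) then 1 else 0
  have key := canonicalModel_V.{u} (R := R) ⟨v, hv⟩
    (fun v _ w _ B hB => by
      simp only [R]
      split_ifs with hR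
      · exact (min_le_left _ _).trans (hR B hB)
      · exact (min_le_right _ _).trans unitInterval.nonneg')
    (fun v hv B _ d hd hdB => by
      obtain ⟨w, hw, hwB, hwS, hwQ⟩ := hT.exists_witness hv A.finite_args hd hdB
        -- Crisp accessibility also needs `w D ≤ v (◇D)` when `v (◇B) ≤ v (◇D) < 1`. Such `D` are
        -- kept below 1, hence below `v (◇B)` after rescaling; the rule with side formula permits
        -- this.
        (hT.isDirectedIn_lt hv one_pos) (by
          intro C hC D hD hmem
          have h1 := hv.2 _ (HGKDia.nec hmem)
          rw [hv.1.or, hv.1.imp] at h1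
          have h2 : gimp (v (.dia B)) (v (.dia C)) < 1 :=
            lt_of_le_of_ne unitInterval.le_one' fun h => not_le.2 hC (gimp_eq_one.1 h)
          exact (max_lt h2 hD).ne h1)
      have hR : R v w = 1 := if_pos fun C hC => by
        rcases lt_or_ge (v (.dia C)) (v (.dia B)) with hCB | hCB
        · exact hwS C hC hCB
        · rcases eq_or_lt_of_le (unitInterval.le_one' (t := v (.dia C))) with h1 | h1
          · exact h1 ▸ unitInterval.le_one'
          · exact (hwQ C h1).le.trans hCB
      refine ⟨w, hw, le_min hwB ?_⟩
      rw [hR]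
      exact unitInterval.le_one')
    (subset_refl A.args) ⟨⟨v, hv⟩⟩
  refine (hvA A rfl).ne (key.symm.trans (h _ (fun x y => ?_) _))
  simp only [canonicalModel, R]
  split_ifs
  · exact Or.inr rfl
  · exact Or.inl rfl

end GodelModal

theorem mainTheorem4 (A : GodelModal.DiaFm) :
    (GodelModal.GKValid.{u} A.toFm ↔ GodelModal.HGKDia A) ∧
      (GodelModal.GKFValid.{u} A.toFm ↔ GodelModal.HGKFDia A) :=
  ⟨⟨fun h => GodelModal.HGKDia.complete h, fun h K hK => h.sound K hK⟩,
    ⟨fun h => GodelModal.HGKFDia.complete h, fun h K => h.sound K⟩⟩
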